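/- Let $q>2$ be a prime power, let $\mathcal Q=\mathsf Q^-(5,q)$ be an elliptic quadric of $\mathrm{PG}(5,q)$ with associated polarity $\perp$, and let $H$ be a hyperplane meeting $\mathcal Q$ in a parabolic quadric $\mathsf Q(4,q)$. Let $X=\mathcal Q\setminus H$ be the set of points of $\mathcal Q$ not in $H$. For $p\in X$ let $p^\sigma$ be the unique second point of $\mathcal Q$ on the line joining $p$ and the point $H^\perp$; this defines a fixed-point-free involution $\sigma$ of $X$. Write $u\sim v$ if $u\ne v$ and $v\in u^\perp$. Consider the Penttila–Williford association scheme on $X$ with relations $$\begin{aligned} R_0&=\{(u,v): u=v\},\qquad R_4=\{(u,v): u=v^\sigma\},\\ R_1&=\{(u,v): v\not\sim u\sim v^\sigma\},\qquad R_3=\{(u,v): v\sim u\not\sim v^\sigma\},\\ R_2&=\{(u,v): u\ne v,\ u\neq v^\sigma,\ v\not\sim u\not\sim v^\sigma\}, \end{aligned}$$ let $A_j$ be the adjacency matrix of $(X,R_j)$, and for $i\in\{0,\dots,4\}$ let $V_i=\{v\in\mathbb R^X : A_jv=P_{ij}v \text{ for } j=0,\dots,4\}$ be the eigenspaces of the scheme,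 numbered according to the matrix of eigenvalues (rows and columns indexed by $0,\dots,4$) $$P=\begin{pmatrix} 1&(q-1)(q^2+1)&(q-2)q(q^2+1)&(q-1)(q^2+1)&1\\ 1&q^2+1&0&-(q^2+1)&-1\\ 1&q-1&-2q&q-1&1\\ 1&-(q-1)&0&q-1&-1\\ 1&-(q-1)^2&2(q-2)q&-(q-1)^2&1 \end{pmatrix}.$$ Let $Y\subseteq X$ be a subset whose characteristic vector satisfies $\chi_Y\in V_0\oplus V_i$ for some $i\in\{1,2,3,4\}$. (a) If $i=1$ or $i=3$, and $Y\ne\varnothing$ and $Y\neq X$, then $|Y|=\frac12|X|$ and $|\{p,p^\sigma\}\cap Y|=1$ for all $p\in X$. (b) If $i=2$ or $i=4$, then $Y^\sigma=Y$. -/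

import Mathlib

open scoped LinearAlgebra.Projectivization

namespace PentWil

variable {K : Type*} [Field K]

/-- The subspace `W^⊥` for the polarity `⊥` associated with the quadratic form `Q`. -/
def perp (Q : QuadraticForm K (Fin 6 → K)) (W : Submodule K (Fin 6 → K)) :
    Submodule K (Fin 6 → K) :=
  LinearMap.BilinForm.orthogonal Q.polarBilin W

/-- A subspace is totally singular if the quadratic form vanishes on it, that is, if the
corresponding projective subspace is contained in the quadric. -/
def IsTotallySingular (Q : QuadraticForm K (Fin 6 → K)) (W : Submodule K (Fin 6 → K)) : Prop :=
  ∀ x ∈ W, Q x = 0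

/-- `Q` defines an elliptic quadric of `PG(5, K)`: it is nondegenerate and has Witt index `2`
(the maximal projective subspaces contained in the quadric are lines). -/
structure IsElliptic (Q : QuadraticForm K (Fin 6 → K)) : Prop where
  nondegenerate : Q.polarBilin.Nondegenerate
  exists_line : ∃ W : Submodule K (Fin 6 → K), Module.finrank K W = 2 ∧ IsTotallySingular Q W
  finrank_le : ∀ W : Submodule K (Fin 6 → K), IsTotallySingular Q W → Module.finrank K W ≤ 2

/-- `H` is a hyperplane of `PG(5, K)` meeting the quadric of `Q` in a parabolic quadric `Q(4, K)`:
the restriction of `Q` to the five-dimensional subspace `H` is nonsingular, that is, no nonzero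
singular vector of `H` is perpendicular to all of `H`. (In even characteristic the polar form of
the restriction does have a one-dimensional radical, the nucleus.) -/
structure IsParabolicHyperplane (Q : QuadraticForm K (Fin 6 → K))
    (H : Submodule K (Fin 6 → K)) : Prop where
  finrank_eq : Module.finrank K H = 5
  nonsingular : (Q.comp H.subtype).radical = ⊥

/-- The set `X` of points of the quadric of `Q` that do not lie in `H`. -/
def Point (Q : QuadraticForm K (Fin 6 → K)) (H : Submodule K (Fin 6 → K)) : Type _ :=
  {p : ℙ K (Fin 6 → K) // IsTotallySingular Q p.submodule ∧ ¬ p.submodule ≤ H}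

section

variable (Q : QuadraticForm K (Fin 6 → K)) (H : Submodule K (Fin 6 → K))

instance [Finite K] : Finite (Point Q H) := by
  unfold Point
  infer_instance

noncomputable instance [Finite K] : Fintype (Point Q H) := Fintype.ofFinite _

open Classical in
/-- The involution `σ` on `X`: the point `σ p` is the second point of the quadric on the line
joining `p` and the point `H^⊥`; see `sigma_spec` (the value in the `else` branch never matters). -/
noncomputable def sigma (p : Point Q H) : Point Q H :=
  if h : ∃ p' : Point Q H, p' ≠ p ∧ p'.1.submodule ≤ perp Q H ⊔ p.1.submodule
  then h.choose else p

/-- Two points of `X` are collinear if they are distinct and perpendicular, that is, if they span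
a line contained in the quadric. -/
def Collinear (u v : Point Q H) : Prop :=
  u ≠ v ∧ v.1.submodule ≤ perp Q u.1.submodule

/-- The relations `R_0, …, R_4` of the Penttila–Williford scheme on `X`. -/
def Rel : Fin 5 → Point Q H → Point Q H → Prop :=
  ![fun u v => u = v,
    fun u v => ¬ Collinear Q H u v ∧ Collinear Q H u (sigma Q H v),
    fun u v => u ≠ v ∧ u ≠ sigma Q H v ∧
      ¬ Collinear Q H u v ∧ ¬ Collinear Q H u (sigma Q H v),
    fun u v => Collinear Q H u v ∧ ¬ Collinear Q H u (sigma Q H v),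
    fun u v => u = sigma Q H v]

open Classical in
/-- The adjacency matrix `A_j` of the graph `(X, R_j)`. -/
noncomputable def adj (j : Fin 5) : Matrix (Point Q H) (Point Q H) ℝ :=
  Matrix.of fun u v => if Rel Q H j u v then 1 else 0

/-- The matrix of eigenvalues of the scheme: the entry in row `i` and column `j` is the eigenvalue
of `A_j` on `V_i`. -/
def eigenvalueMatrix (q : ℝ) : Matrix (Fin 5) (Fin 5) ℝ :=
  !![1, (q - 1) * (q ^ 2 + 1), (q - 2) * q * (q ^ 2 + 1), (q - 1) * (q ^ 2 + 1), 1;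
     1, q ^ 2 + 1, 0, -(q ^ 2 + 1), -1;
     1, q - 1, -2 * q, q - 1, 1;
     1, -(q - 1), 0, q - 1, -1;
     1, -(q - 1) ^ 2, 2 * (q - 2) * q, -(q - 1) ^ 2, 1]

/-- The eigenspace `V_i` of the association scheme: the common eigenspace of `A_0, …, A_4` for the
eigenvalues in row `i` of the matrix of eigenvalues, where `q = |K|`. -/
noncomputable def eigenspace [Fintype K] (i : Fin 5) : Submodule ℝ (Point Q H → ℝ) :=
  ⨅ j : Fin 5, Module.End.eigenspace (Matrix.mulVecLin (adj Q H j))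
    (eigenvalueMatrix (Fintype.card K : ℝ) i j)

/-- The characteristic vector `χ_Y` of a subset `Y` of `X`. -/
noncomputable def chi (Y : Set (Point Q H)) : Point Q H → ℝ :=
  Y.indicator 1

end

theorem exists_center {Q : QuadraticForm K (Fin 6 → K)} {H : Submodule K (Fin 6 → K)}
    (hQ : IsElliptic Q) (hH : IsParabolicHyperplane Q H) :
    ∃ z : Fin 6 → K, perp Q H = K ∙ z ∧ Q z ≠ 0 ∧
      ∀ x, x ∈ H ↔ QuadraticMap.polar Q z x = 0 := by
  have hrefl : LinearMap.IsRefl Q.polarBilin := by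
    intro x y h
    rw [QuadraticMap.polarBilin_apply_apply] at h ⊢
    rw [QuadraticMap.polar_comm]; exact h
  have hfr : Module.finrank K (perp Q H) = 1 := by
    unfold perp
    rw [LinearMap.BilinForm.finrank_orthogonal hQ.nondegenerate, hH.finrank_eq]
    simp
  obtain ⟨z, hz0, hz⟩ := finrank_eq_one_iff'.1 hfr
  have hspan : perp Q H = K ∙ (z : Fin 6 → K) := by
    apply le_antisymm
    · intro w hw
      obtain ⟨c, hc⟩ := hz ⟨w, hw⟩
      exact Submodule.mem_span_singleton.2 ⟨c, congrArg Subtype.val hc⟩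
    · rw [Submodule.span_singleton_le_iff_mem]; exact z.2
  have hmem : ∀ x, x ∈ H ↔ QuadraticMap.polar Q z x = 0 := by
    intro x
    constructor
    · intro hx
      have h := z.2
      unfold perp at h
      have := hrefl _ _ (LinearMap.BilinForm.mem_orthogonal_iff.1 h x hx)
      simpa using this
    · intro hx
      have h2 : perp Q (perp Q H) = H :=
        LinearMap.BilinForm.orthogonal_orthogonal hQ.nondegenerate hrefl H
      rw [← h2]
      unfold perp
      rw [LinearMap.BilinForm.mem_orthogonal_iff]
      intro n hn
      change n ∈ perp Q H at hn
      rw [hspan] at hn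
      obtain ⟨c, rfl⟩ := Submodule.mem_span_singleton.1 hn
      change Q.polarBilin (c • (z : Fin 6 → K)) x = 0
      simp [hx]
  refine ⟨z, hspan, ?_, hmem⟩
  intro hQz
  have hzH : (z : Fin 6 → K) ∈ H := by
    rw [hmem, QuadraticMap.polar_self, hQz, smul_zero]
  have hr : (⟨z, hzH⟩ : H) ∈ (Q.comp H.subtype).radical := by
    rw [QuadraticMap.mem_radical_iff']
    refine ⟨hQz, fun n => ?_⟩
    have := (hmem n).1 n.2
    simp only [QuadraticMap.polar, hQz, sub_zero, sub_eq_zero] at this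
    exact this
  rw [hH.nonsingular, Submodule.mem_bot] at hr
  have hr' : (z : Fin 6 → K) = 0 := by
    simpa using congrArg (fun v : H => (v : Fin 6 → K)) hr
  exact hz0 (Subtype.ext hr')

/-- For `p ∈ X`, the line joining `p` and `H^⊥` meets the quadric in exactly one point other than
`p`; this point lies in `X` and is `σ p`. -/
theorem sigma_spec {Q : QuadraticForm K (Fin 6 → K)} {H : Submodule K (Fin 6 → K)}
    (hQ : IsElliptic Q) (hH : IsParabolicHyperplane Q H) (p : Point Q H) :
    sigma Q H p ≠ p ∧ (sigma Q H p).1.submodule ≤ perp Q H ⊔ p.1.submodule ∧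
      ∀ p' : ℙ K (Fin 6 → K), IsTotallySingular Q p'.submodule → p' ≠ p.1 →
        p'.submodule ≤ perp Q H ⊔ p.1.submodule → p' = (sigma Q H p).1 := by
  obtain ⟨z, hz, hQz, hmem⟩ := exists_center hQ hH
  obtain ⟨⟨p, hp1, hp2⟩, rfl⟩ : ∃ p₀, p = p₀ := ⟨p, rfl⟩
  induction p using Projectivization.ind with
  | h x hx =>
  rw [Projectivization.submodule_mk] at hp1 hp2
  have hQx : Q x = 0 := hp1 x (Submodule.mem_span_singleton_self x)
  have hxH : QuadraticMap.polar Q z x ≠ 0 := by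
    rwa [Submodule.span_singleton_le_iff_mem, hmem] at hp2
  set b := QuadraticMap.polar Q z x with hb
  have hQcomb : ∀ s t : K, Q (s • z + t • x) = s * (s * Q z + t * b) := by
    intro s t
    have h : QuadraticMap.polar Q (s • z) (t • x) = s * (t * b) := by
      rw [QuadraticMap.polar_smul_left, QuadraticMap.polar_smul_right, smul_eq_mul, smul_eq_mul]
    have h2 : Q (s • z + t • x) = QuadraticMap.polar Q (s • z) (t • x)
        + Q (s • z) + Q (t • x) := by
      rw [QuadraticMap.polar]; ring
    rw [h2, h, QuadraticMap.map_smul, QuadraticMap.map_smul, hQx]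
    simp only [smul_eq_mul]
    ring
  set y : Fin 6 → K := (-(b / Q z)) • z + (1 : K) • x with hy
  have hQy : Q y = 0 := by
    rw [hy, hQcomb]; field_simp; ring
  have hyb : QuadraticMap.polar Q z y = -b := by
    rw [hy, QuadraticMap.polar_add_right, QuadraticMap.polar_smul_right,
      QuadraticMap.polar_smul_right, QuadraticMap.polar_self, ← hb]
    simp only [smul_eq_mul, nsmul_eq_mul]
    field_simp
    push_cast
    ring
  have hy0 : y ≠ 0 := by
    intro h
    rw [h, QuadraticMap.polar_zero_right] at hyb
    exact hxH (by rw [← neg_neg b, ← hyb, neg_zero])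
  have hyx : Projectivization.mk K y hy0 ≠ Projectivization.mk K x hx := by
    intro h
    obtain ⟨a, ha⟩ := (Projectivization.mk_eq_mk_iff' K _ _ _ _).1 h
    have hz' : (b / Q z) • z = (1 - a) • x := by
      rw [sub_smul, ha, hy]; simp
    have h0 : b / Q z ≠ 0 := div_ne_zero hxH hQz
    have : Q ((b / Q z) • z) = 0 := by rw [hz', QuadraticMap.map_smul, hQx, smul_zero]
    rw [QuadraticMap.map_smul, smul_eq_mul] at this
    exact (mul_ne_zero (mul_ne_zero h0 h0) hQz) this
  have hline : (Projectivization.mk K y hy0).submodule ≤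
      perp Q H ⊔ (Projectivization.mk K x hx).submodule := by
    rw [Projectivization.submodule_mk, Projectivization.submodule_mk, hz,
      Submodule.span_singleton_le_iff_mem, ← Submodule.span_insert]
    exact Submodule.mem_span_pair.2 ⟨_, _, rfl⟩
  have huniq : ∀ p' : ℙ K (Fin 6 → K), IsTotallySingular Q p'.submodule →
      p' ≠ Projectivization.mk K x hx →
      p'.submodule ≤ perp Q H ⊔ (Projectivization.mk K x hx).submodule →
      p' = Projectivization.mk K y hy0 := by
    intro p' hs hne hle
    induction p' using Projectivization.ind with
    | h w hw =>
    rw [Projectivization.submodule_mk] at hs hle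
    rw [Projectivization.submodule_mk, hz, Submodule.span_singleton_le_iff_mem,
      ← Submodule.span_insert, Submodule.mem_span_pair] at hle
    obtain ⟨s, t, hst⟩ := hle
    have hQw : s * (s * Q z + t * b) = 0 := by
      rw [← hQcomb, hst]; exact hs w (Submodule.mem_span_singleton_self w)
    have hs0 : s ≠ 0 := by
      rintro rfl
      apply hne
      rw [Projectivization.mk_eq_mk_iff']
      exact ⟨t, by rw [← hst]; simp⟩
    have h1 : s * Q z + t * b = 0 := (mul_eq_zero.1 hQw).resolve_left hs0
    rw [Projectivization.mk_eq_mk_iff']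
    refine ⟨t, ?_⟩
    rw [← hst, hy, smul_add, smul_smul, smul_smul, mul_one]
    congr 2
    field_simp
    linear_combination -h1
  have hyX : IsTotallySingular Q (Projectivization.mk K y hy0).submodule ∧
      ¬ (Projectivization.mk K y hy0).submodule ≤ H := by
    rw [Projectivization.submodule_mk]
    constructor
    · intro w hw
      obtain ⟨c, rfl⟩ := Submodule.mem_span_singleton.1 hw
      rw [QuadraticMap.map_smul, hQy, smul_zero]
    · rw [Submodule.span_singleton_le_iff_mem, hmem, hyb, neg_eq_zero]
      exact hxH
  have hex : ∃ p' : Point Q H, p' ≠ ⟨Projectivization.mk K x hx, by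
      rw [Projectivization.submodule_mk]; exact ⟨hp1, hp2⟩⟩ ∧
      p'.1.submodule ≤ perp Q H ⊔ (Projectivization.mk K x hx).submodule :=
    ⟨⟨_, hyX⟩, fun h => hyx (congrArg Subtype.val h), hline⟩
  have hσ : sigma Q H ⟨Projectivization.mk K x hx, by
      rw [Projectivization.submodule_mk]; exact ⟨hp1, hp2⟩⟩ = hex.choose := by
    unfold sigma
    exact dif_pos hex
  refine ⟨?_, ?_, ?_⟩
  · rw [hσ]; exact hex.choose_spec.1
  · rw [hσ]; exact hex.choose_spec.2
  · intro p' h1 h2 h3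
    rw [hσ, huniq p' h1 h2 h3]
    exact (huniq _ hex.choose.2.1 (fun h => hex.choose_spec.1 (Subtype.ext h))
      hex.choose_spec.2).symm

end PentWil

namespace PentWil

/-! ### Geometry of the involution `σ`. -/

section

variable {K : Type*} [Field K] {Q : QuadraticForm K (Fin 6 → K)} {H : Submodule K (Fin 6 → K)}

/-! `A_4` is the permutation matrix of `σ`, so every `g ∈ V_i` satisfies `g ∘ σ = P_{i4} g`: it is
odd under `σ` for `i = 1, 3` and even for `i = 2, 4`. Functions in `V_0` are constant, because the
`A_j` sum to the all-ones matrix (`sum_adj`). Write `χ_Y = f + g` with `f` constant and `g ∈ V_i`.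
If `g` is even, `χ_Y` is `σ`-invariant. If `g` is odd, `χ_Y(u) + χ_Y(σ u)` does not depend on `u`;
it is neither 0 nor 2 when `Y` is nonempty and proper, so `Y` meets each pair `{p, σ p}` once and
`σ` swaps `Y` with its complement. Of `P`, only column 4 and the sum of row 0 are used. -/

theorem mem_perp_iff (W : Submodule K (Fin 6 → K)) (x : Fin 6 → K) :
    x ∈ perp Q W ↔ ∀ y ∈ W, QuadraticMap.polar Q y x = 0 := by
  unfold perp
  rw [LinearMap.BilinForm.mem_orthogonal_iff]
  rfl

/-- The lines joining `H^⊥` to `p` and to `σ p` coincide, so uniqueness in `sigma_spec`, applied at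
`σ p`, returns `p`. -/
theorem sigma_sigma (hQ : IsElliptic Q) (hH : IsParabolicHyperplane Q H) (p : Point Q H) :
    sigma Q H (sigma Q H p) = p := by
  obtain ⟨z, hz, hQz, -⟩ := exists_center hQ hH
  obtain ⟨hne, hle, -⟩ := sigma_spec hQ hH p
  obtain ⟨-, -, huniq⟩ := sigma_spec hQ hH (sigma Q H p)
  refine (Subtype.ext (huniq p.1 p.2.1 (fun h => hne (Subtype.ext h.symm)) ?_)).symm
  have hs := (sigma Q H p).2.1 _ (by
    rw [Projectivization.submodule_eq]; exact Submodule.mem_span_singleton_self _)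
  have hr := (sigma Q H p).1.rep_nonzero
  rw [hz, Projectivization.submodule_eq, Projectivization.submodule_eq,
    Submodule.span_singleton_le_iff_mem, ← Submodule.span_insert, Submodule.mem_span_pair] at hle ⊢
  obtain ⟨s, t, hst⟩ := hle
  -- If `t = 0`, then `σ p` would be the point `H^⊥`, which is off the quadric.
  have ht : t ≠ 0 := by
    rintro rfl
    rw [zero_smul, add_zero] at hst
    rw [← hst, QuadraticMap.map_smul, smul_eq_mul] at hs
    have hs0 : s = 0 := by simpa [hQz] using hs
    exact hr (by rw [← hst, hs0, zero_smul])
  refine ⟨-(t⁻¹ * s), t⁻¹, ?_⟩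
  rw [← hst, smul_add, smul_smul, smul_smul, inv_mul_cancel₀ ht, one_smul, neg_smul]
  abel

/-- No point of `X` is perpendicular to both `v` and `σ v`. -/
theorem not_le_perp_sigma (hQ : IsElliptic Q) (hH : IsParabolicHyperplane Q H) {u v : Point Q H}
    (hv : v.1.submodule ≤ perp Q u.1.submodule)
    (hs : (sigma Q H v).1.submodule ≤ perp Q u.1.submodule) : False := by
  obtain ⟨z, hz, -, hmem⟩ := exists_center hQ hH
  obtain ⟨hne, hle, -⟩ := sigma_spec hQ hH v
  apply u.2.2
  have hu : u.1.rep ∈ u.1.submodule := by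
    rw [Projectivization.submodule_eq]; exact Submodule.mem_span_singleton_self _
  rw [Projectivization.submodule_eq, Submodule.span_singleton_le_iff_mem, mem_perp_iff] at hv hs
  rw [hz, Projectivization.submodule_eq, Projectivization.submodule_eq,
    Submodule.span_singleton_le_iff_mem, ← Submodule.span_insert, Submodule.mem_span_pair] at hle
  obtain ⟨s, t, hst⟩ := hle
  have hs0 : s ≠ 0 := by
    rintro rfl
    apply hne
    apply Subtype.ext
    rw [← Projectivization.mk_rep (sigma Q H v).1, ← Projectivization.mk_rep v.1,
      Projectivization.mk_eq_mk_iff']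
    exact ⟨t, by rw [← hst]; simp⟩
  -- Since `u ⊥ v`, pairing `u` with `s z + t v` leaves `s` times its pairing with `z`; hence `u ⊥
  -- z`, which puts `u` in `H`.
  have h1 := hs _ hu
  rw [← hst, QuadraticMap.polar_add_right, QuadraticMap.polar_smul_right,
    QuadraticMap.polar_smul_right, hv _ hu, smul_zero, add_zero, smul_eq_mul] at h1
  rw [Projectivization.submodule_eq, Submodule.span_singleton_le_iff_mem, hmem,
    QuadraticMap.polar_comm]
  exact (mul_eq_zero.1 h1).resolve_left hs0

theorem le_perp_self (u : Point Q H) : u.1.submodule ≤ perp Q u.1.submodule := by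
  intro x hx
  rw [mem_perp_iff]
  intro y hy
  rw [QuadraticMap.polar, u.2.1 _ (add_mem hy hx), u.2.1 _ hx, u.2.1 _ hy]
  simp

theorem not_collinear_sigma_self (hQ : IsElliptic Q) (hH : IsParabolicHyperplane Q H)
    (u : Point Q H) : ¬ Collinear Q H u (sigma Q H u) :=
  fun h => not_le_perp_sigma hQ hH (le_perp_self u) h.2

theorem not_collinear_sigma_left (hQ : IsElliptic Q) (hH : IsParabolicHyperplane Q H)
    (v : Point Q H) : ¬ Collinear Q H (sigma Q H v) v :=
  fun h => not_le_perp_sigma hQ hH h.2 (le_perp_self (sigma Q H v))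

theorem not_collinear_self (u : Point Q H) : ¬ Collinear Q H u u := fun h => h.1 rfl

/-- The relations `R_0, …, R_4` partition `X × X`. -/
theorem sum_adj (hQ : IsElliptic Q) (hH : IsParabolicHyperplane Q H) (u v : Point Q H) :
    ∑ j, adj Q H j u v = 1 := by
  have h1 := not_collinear_sigma_self hQ hH v
  have h2 := not_collinear_sigma_left hQ hH v
  have h3 := not_collinear_self v
  have h4 := not_collinear_self (sigma Q H v)
  have h5 := (sigma_spec hQ hH v).1
  -- A pair with both collinearities would belong to none of the five relations.
  have h6 : ¬ (Collinear Q H u v ∧ Collinear Q H u (sigma Q H v)) :=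
    fun h => not_le_perp_sigma hQ hH h.1.2 h.2.2
  simp only [Fin.sum_univ_five, adj, Matrix.of_apply, Rel, Matrix.cons_val]
  by_cases e0 : u = v
  · subst e0
    simp [h1, h3, h5.symm]
  by_cases e4 : u = sigma Q H v
  · subst e4
    simp [h2, h4, h5]
  by_cases c : Collinear Q H u v <;> by_cases c' : Collinear Q H u (sigma Q H v) <;>
    simp_all

/-! ### From symmetry of the characteristic vector to the set. -/

theorem sigma_image_eq_of_chi (hQ : IsElliptic Q) (hH : IsParabolicHyperplane Q H)
    {Y : Set (Point Q H)} (h : ∀ u, chi Q H Y (sigma Q H u) = chi Q H Y u) :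
    sigma Q H '' Y = Y := by
  have hmem : ∀ u, sigma Q H u ∈ Y ↔ u ∈ Y := by
    intro u
    have := h u
    by_cases h1 : sigma Q H u ∈ Y <;> by_cases h2 : u ∈ Y <;> simp_all [chi]
  ext u
  constructor
  · rintro ⟨v, hv, rfl⟩
    exact (hmem v).2 hv
  · exact fun hu => ⟨sigma Q H u, (hmem u).2 hu, sigma_sigma hQ hH u⟩

/-- The common pair sum is 0, 1 or 2; a point in `Y` excludes 0 and a point outside `Y` excludes 2.
-/
theorem mem_iff_sigma_notMem {Y : Set (Point Q H)} (hne : Y.Nonempty) (huniv : Y ≠ Set.univ)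
    (h : ∀ u v, chi Q H Y u + chi Q H Y (sigma Q H u) = chi Q H Y v + chi Q H Y (sigma Q H v))
    (p : Point Q H) : p ∈ Y ↔ sigma Q H p ∉ Y := by
  obtain ⟨a, ha⟩ := hne
  obtain ⟨b, hb⟩ := (Set.ne_univ_iff_exists_notMem Y).1 huniv
  have ea := h p a
  have eb := h p b
  by_cases h1 : p ∈ Y <;> by_cases h2 : sigma Q H p ∈ Y <;>
    by_cases h3 : sigma Q H a ∈ Y <;> by_cases h4 : sigma Q H b ∈ Y <;>
    simp [chi, ha, hb, h1, h2, h3, h4] at ea eb ⊢ <;> linarith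

theorem ncard_pair_inter {Y : Set (Point Q H)} (h : ∀ p, p ∈ Y ↔ sigma Q H p ∉ Y) (p : Point Q H) :
    (({p, sigma Q H p} : Set (Point Q H)) ∩ Y).ncard = 1 := by
  rw [Set.ncard_eq_one]
  by_cases hp : p ∈ Y
  · exact ⟨p, by rw [Set.insert_inter_of_mem hp,
      Set.singleton_inter_eq_empty.2 ((h p).1 hp)]; simp⟩
  · have hs : sigma Q H p ∈ Y := by
      by_contra hs
      exact hp ((h p).2 hs)
    exact ⟨sigma Q H p, by rw [Set.insert_inter_of_notMem hp]; simpa using hs⟩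

/-! ### Eigenvectors of the scheme, and the size of `Y`. -/

variable [Fintype K]

theorem mem_eigenspace_iff (i : Fin 5) (f : Point Q H → ℝ) :
    f ∈ eigenspace Q H i ↔ ∀ j, Matrix.mulVec (adj Q H j) f =
      eigenvalueMatrix (Fintype.card K : ℝ) i j • f := by
  simp [eigenspace, Submodule.mem_iInf]

theorem adj_four_mulVec (hQ : IsElliptic Q) (hH : IsParabolicHyperplane Q H)
    (f : Point Q H → ℝ) (u : Point Q H) :
    Matrix.mulVec (adj Q H 4) f u = f (sigma Q H u) := by
  have h : ∀ v, u = sigma Q H v ↔ v = sigma Q H u := fun v =>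
    ⟨fun h => by rw [h, sigma_sigma hQ hH], fun h => by rw [h, sigma_sigma hQ hH]⟩
  classical
  simp [Matrix.mulVec, dotProduct, adj, Rel, h]

theorem apply_sigma_of_mem_eigenspace (hQ : IsElliptic Q) (hH : IsParabolicHyperplane Q H)
    {i : Fin 5} {f : Point Q H → ℝ} (hf : f ∈ eigenspace Q H i) (u : Point Q H) :
    f (sigma Q H u) = eigenvalueMatrix (Fintype.card K : ℝ) i 4 * f u := by
  rw [← adj_four_mulVec hQ hH f u, (mem_eigenspace_iff i f).1 hf 4]
  rfl

/-- The functions in `V_0` are constant. -/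
theorem eq_of_mem_eigenspace_zero (hQ : IsElliptic Q) (hH : IsParabolicHyperplane Q H)
    {f : Point Q H → ℝ} (hf : f ∈ eigenspace Q H 0) (u v : Point Q H) : f u = f v := by
  have hq : (1 : ℝ) < Fintype.card K := by exact_mod_cast Fintype.one_lt_card
  set q : ℝ := (Fintype.card K : ℝ) with hqdef
  -- Apply the all-ones matrix `∑ A_j` to `f`; the factor is the sum of row 0 of `P`, nonzero
  -- because `q > 1`.
  have key : ∀ w, ∑ x, f x = q ^ 2 * (q ^ 2 - 1) * f w := by
    intro w
    have h1 : ∑ j, Matrix.mulVec (adj Q H j) f w = ∑ x, f x := by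
      simp only [Matrix.mulVec, dotProduct]
      rw [Finset.sum_comm]
      simp only [← Finset.sum_mul, sum_adj hQ hH, one_mul]
    rw [← h1, Finset.sum_congr rfl fun j _ => congrFun ((mem_eigenspace_iff 0 f).1 hf j) w]
    simp only [Fin.sum_univ_five, Pi.smul_apply, smul_eq_mul, eigenvalueMatrix, Matrix.of_apply,
      Matrix.cons_val, ← hqdef]
    ring
  have hn : q ^ 2 * (q ^ 2 - 1) ≠ 0 := by
    have : 0 < q ^ 2 - 1 := by nlinarith
    positivity
  exact mul_left_cancel₀ hn ((key u).symm.trans (key v))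

/-- The injection `σ` carries `Y` onto its complement. -/
theorem two_mul_ncard_of_mem_iff (hQ : IsElliptic Q) (hH : IsParabolicHyperplane Q H)
    {Y : Set (Point Q H)} (h : ∀ p, p ∈ Y ↔ sigma Q H p ∉ Y) :
    2 * Y.ncard = Nat.card (Point Q H) := by
  have hc : sigma Q H '' Y = Yᶜ := by
    ext u
    constructor
    · rintro ⟨v, hv, rfl⟩
      exact (h v).1 hv
    · intro hu
      refine ⟨sigma Q H u, ?_, sigma_sigma hQ hH u⟩
      by_contra hs
      exact hu ((h u).2 hs)
  have hi : Function.Injective (sigma Q H) :=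
    Function.LeftInverse.injective (sigma_sigma hQ hH)
  have h1 := Set.ncard_add_ncard_compl Y
  rw [← hc, Set.ncard_image_of_injective Y hi] at h1
  omega

end

end PentWil

theorem mainTheorem2 {K : Type*} [Field K] [Fintype K] (hK : 2 < Fintype.card K)
    (Q : QuadraticForm K (Fin 6 → K)) (hQ : PentWil.IsElliptic Q)
    (H : Submodule K (Fin 6 → K)) (hH : PentWil.IsParabolicHyperplane Q H)
    (Y : Set (PentWil.Point Q H)) (i : Fin 5)
    (hY : PentWil.chi Q H Y ∈ PentWil.eigenspace Q H 0 ⊔ PentWil.eigenspace Q H i) :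
    ((i = 1 ∨ i = 3) → Y.Nonempty → Y ≠ Set.univ →
      (Y.ncard : ℚ) = (Nat.card (PentWil.Point Q H) : ℚ) / 2 ∧
        ∀ p : PentWil.Point Q H,
          (({p, PentWil.sigma Q H p} : Set (PentWil.Point Q H)) ∩ Y).ncard = 1) ∧
    ((i = 2 ∨ i = 4) → PentWil.sigma Q H '' Y = Y) := by
  obtain ⟨f, hf, g, hg, hfg⟩ := Submodule.mem_sup.1 hY
  have hfσ : ∀ u, f (PentWil.sigma Q H u) = f u := fun u =>
    PentWil.eq_of_mem_eigenspace_zero hQ hH hf _ _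
  have hgσ := PentWil.apply_sigma_of_mem_eigenspace hQ hH hg
  constructor
  · intro hi hne huniv
    -- Here `P_{i4} = -1`, so `g` cancels from the pair sums.
    have hg' : ∀ u, g (PentWil.sigma Q H u) = -g u := by
      intro u
      rw [hgσ u]
      rcases hi with rfl | rfl <;> simp [PentWil.eigenvalueMatrix]
    have h := PentWil.mem_iff_sigma_notMem hne huniv fun u v => by
      simp only [← hfg, Pi.add_apply, hfσ, hg', PentWil.eq_of_mem_eigenspace_zero hQ hH hf u v]
      ring
    refine ⟨?_, PentWil.ncard_pair_inter h⟩
    rw [← PentWil.two_mul_ncard_of_mem_iff hQ hH h]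
    push_cast
    ring
  · intro hi
    apply PentWil.sigma_image_eq_of_chi hQ hH
    intro u
    simp only [← hfg, Pi.add_apply, hfσ, hgσ]
    -- Here `P_{i4} = 1`.
    rcases hi with rfl | rfl <;> simp [PentWil.eigenvalueMatrix]
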